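/- There are $n\ge 2$ prisoners, labelled $1,\dots,n$, and $r\ge 1$ indistinguishable rooms. Each room has a single switch with three configurations $0,1,2$, and it is known that all rooms start in configuration $0$. The prisoners are led into rooms one at a time, in an arbitrary order. A prisoner led into a room sees only the configuration of that room; depending on it and on his own memory, he may reconfigure the room. A prisoner may declare that every prisoner has been in every room. Each prisoner executes a program, a list of commands carried out in order, at most one command being carried out or continued per visit: - FLIP$(a\to b)$: wait until you see a room in configuration $a$, then reconfigure it to $b$. - SEE$(a)$: wait until you see a room in configuration $a$. - OSCILLATE$(a\leftrightarrow b)$: upon entering a room in configuration $a$, reconfigure it to $b$; upon entering a room in configuration $b$, reconfigure it to $a$; continue until, within this command, you have performed the former operation more times than the latter. - DECLARE: make the declaration (as soon as this command is reached). Write $[\dots]^m$ for $m$ repetitions of a block, and let $$A=[\mathrm{FLIP}(0\to1)]^{n+r-1}\,[\mathrm{FLIP}(1\to2)]^{n+r-1}\,[\mathrm{FLIP}(2\to0)]^{n+r-1}$$ (the commands of an active prisoner), $U=\mathrm{FLIP}(1\to0)\,\mathrm{FLIP}(2\to1)\,\mathrm{FLIP}(0\to2)$ and $V=\mathrm{FLIP}(2\to1)\,\mathrm{FLIP}(0\to2)\,\mathrm{FLIP}(1\to0)$.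 The programs are: - prisoner $1$: $\;A\;\mathrm{OSCILLATE}(1\leftrightarrow0)\;[V]^{n-1}$; - prisoner $k$, $1<k<n$: $\;[U]^{k-1}\;\mathrm{SEE}(1)\;A\;\mathrm{OSCILLATE}(1\leftrightarrow0)\;[V]^{n-k}$; - prisoner $n$: $\;[U]^{n-1}\;\mathrm{SEE}(1)\;A\;\mathrm{DECLARE}$. **Theorem.** For all $n\ge2$ and $r\ge1$ this protocol wins with probability $1$ when all rooms start in configuration $0$, that is: 1. the prisoners never declare incorrectly: whenever, after some finite sequence of visits, a prisoner declares, every prisoner has been in every room during that sequence; 2. there is a bound $B$ (depending only on $n$ and $r$) such that every finite sequence of visits can be continued by at most $B$ further visits so that the prisoners have declared. -/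

import Mathlib

/-! ### Protocols, rooms and visits -/

/-- A deterministic protocol for `n` prisoners whose rooms have configurations in `C`.
Each prisoner carries a private memory. When led into a room the prisoner sees only the
configuration of that room; as a function of this and of the memory, the prisoner updates the
memory and chooses the configuration in which to leave the room.
`Declares p s` says that prisoner `p` makes the declaration upon getting into memory state `s`. -/
structure Protocol (n : ℕ) (C : Type) where
  Memory : Type
  start : Fin n → Memory
  act : Fin n → Memory → C → Memory × C
  Declares : Fin n → Memory → Prop

/-- A global state of the game with `r` rooms. -/
structure GameState {n : ℕ} {C : Type} (P : Protocol n C) (r : ℕ) where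
  memory : Fin n → P.Memory
  room : Fin r → C

/-- The state before any visit, when the rooms start in the configurations `c₀`. -/
def Protocol.initial {n : ℕ} {C : Type} (P : Protocol n C) {r : ℕ} (c₀ : Fin r → C) :
    GameState P r :=
  { memory := P.start, room := c₀ }

/-- The effect of leading prisoner `v.1` into room `v.2`. -/
def Protocol.visit {n : ℕ} {C : Type} (P : Protocol n C) {r : ℕ} (s : GameState P r)
    (v : Fin n × Fin r) : GameState P r :=
  { memory := Function.update s.memory v.1 (P.act v.1 (s.memory v.1) (s.room v.2)).1
    room := Function.update s.room v.2 (P.act v.1 (s.memory v.1) (s.room v.2)).2 }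

/-- The state after the finite sequence of visits `w`, in order, from the starting
configurations `c₀`. -/
def Protocol.run {n : ℕ} {C : Type} (P : Protocol n C) {r : ℕ} (c₀ : Fin r → C)
    (w : List (Fin n × Fin r)) : GameState P r :=
  w.foldl P.visit (P.initial c₀)

/-- Some prisoner declares in the state reached by the sequence of visits `w`. -/
def Protocol.DeclaresAfter {n : ℕ} {C : Type} (P : Protocol n C) {r : ℕ} (c₀ : Fin r → C)
    (w : List (Fin n × Fin r)) : Prop :=
  ∃ p : Fin n, P.Declares p ((P.run c₀ w).memory p)

/-- The protocol *wins with probability 1* from the starting configurations `c₀`: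
the prisoners never declare incorrectly (whenever someone declares, every prisoner has been in
every room), and after any sequence of visits there is a continuation of bounded length after
which the prisoners declare. -/
def Protocol.WinsWithProbabilityOne {n : ℕ} {C : Type} (P : Protocol n C) {r : ℕ}
    (c₀ : Fin r → C) : Prop :=
  (∀ w : List (Fin n × Fin r), P.DeclaresAfter c₀ w →
    ∀ (p : Fin n) (x : Fin r), (p, x) ∈ w) ∧
  ∃ B : ℕ, ∀ w : List (Fin n × Fin r), ∃ w' : List (Fin n × Fin r),
    w'.length ≤ B ∧ P.DeclaresAfter c₀ (w ++ w')

/-! ### The command language -/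

/-- The commands of the protocol language.
* `flip a b`: wait until you see a room in configuration `a`, then reconfigure it to `b`.
* `see a`: wait until you see a room in configuration `a`.
* `oscillate a b`: upon entering a room in configuration `a`, reconfigure it to `b`; upon entering
  a room in configuration `b`, reconfigure it to `a`; continue until you have performed the
  former operation more times than the latter.
* `declare`: announce that every prisoner has been in every room. -/
inductive Command (C : Type) where
  | flip (a b : C)
  | see (a : C)
  | oscillate (a b : C)
  | declare

/-- `REPEAT k` of a block of commands. -/
def rept {C : Type} (k : ℕ) (block : List (Command C)) : List (Command C) :=
  (List.replicate k block).flatten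

/-- The memory of a prisoner who executes a program: the commands not yet completed, and, while
the current command is `oscillate a b`, the number of times `a` was reconfigured to `b` minus the
number of times `b` was reconfigured to `a` in executing it. -/
structure ProgramState (C : Type) where
  todo : List (Command C)
  balance : ℤ

/-- What a prisoner executing a program does upon entering a room in configuration `c`. -/
def ProgramState.act {C : Type} [DecidableEq C] (s : ProgramState C) (c : C) :
    ProgramState C × C :=
  match s.todo with
  | [] => (s, c)
  | .flip a b :: rest => if c = a then ({ todo := rest, balance := 0 }, b) else (s, c)
  | .see a :: rest => if c = a then ({ todo := rest, balance := 0 }, c) else (s, c)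
  | .oscillate a b :: rest =>
      if c = a then
        if 0 < s.balance + 1 then ({ todo := rest, balance := 0 }, b)
        else ({ todo := s.todo, balance := s.balance + 1 }, b)
      else if c = b then ({ todo := s.todo, balance := s.balance - 1 }, a)
      else (s, c)
  | .declare :: _ => (s, c)

/-- The protocol in which prisoner `p` executes the program `prog p`. A prisoner declares as soon
as `declare` is the command to execute. -/
def programProtocol {n : ℕ} {C : Type} [DecidableEq C] (prog : Fin n → List (Command C)) :
    Protocol n C where
  Memory := ProgramState C
  start p := { todo := prog p, balance := 0 }
  act _ s c := s.act c
  Declares _ s := s.todo.head? = some .declare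

/-! ### The three-configuration protocol -/

/-- The commands of an active prisoner: the 0-phase, the 1-phase and the 2-phase. -/
def activePhases (n r : ℕ) : List (Command (Fin 3)) :=
  rept (n + r - 1) [.flip 0 1] ++ rept (n + r - 1) [.flip 1 2] ++ rept (n + r - 1) [.flip 2 0]

/-- The program of prisoner `1`. -/
def firstProgram (n r : ℕ) : List (Command (Fin 3)) :=
  activePhases n r ++ [.oscillate 1 0] ++ rept (n - 1) [.flip 2 1, .flip 0 2, .flip 1 0]

/-- The program of prisoner `k`, for `1 < k < n`. -/
def middleProgram (n r k : ℕ) : List (Command (Fin 3)) :=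
  rept (k - 1) [.flip 1 0, .flip 2 1, .flip 0 2] ++ [.see 1] ++ activePhases n r ++
    [.oscillate 1 0] ++ rept (n - k) [.flip 2 1, .flip 0 2, .flip 1 0]

/-- The program of prisoner `n`. -/
def lastProgram (n r : ℕ) : List (Command (Fin 3)) :=
  rept (n - 1) [.flip 1 0, .flip 2 1, .flip 0 2] ++ [.see 1] ++ activePhases n r ++ [.declare]

/-- The protocol for `n ≥ 2` prisoners and `r` rooms with configurations `0, 1, 2`; the prisoner
called `k` above, `1 ≤ k ≤ n`, is the element `k - 1` of `Fin n`. -/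
def oscillatingProtocol (n r : ℕ) : Protocol n (Fin 3) :=
  programProtocol fun p =>
    if p.val + 1 = 1 then firstProgram n r
    else if p.val + 1 = n then lastProgram n r
    else middleProgram n r (p.val + 1)

/-! ### Configurations modulo three and the commands of each program -/

/-! Besides the `r` real rooms, each of the `n - 1` prisoners who are not active holds a virtual
room, so `n + r - 1` rooms are in play. During phase `φ` of the active prisoner every one of them
has configuration `φ` or `φ + 1`. A passive prisoner's flip from `φ + 1` to `φ` swaps his virtual
`φ` with a real `φ + 1`, so only the active prisoner increases the number of rooms already advanced.
After `n + r - 1` flips all rooms, real and virtual, have advanced and the next phase begins.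

A configuration `2` created in the 1-phase can come only from the active prisoner, so at the end of
that phase he has been in every real room. After the 2-phase all configurations are `0` again, and
the next prisoner waits for a `1`. The previous one supplies it by oscillating; the resulting excess
of `1`s is recorded as a negative balance, which keeps the count exact and must be repaid before the
0-phase can end.

`InPhase` expresses this state; `InPhase.exists_visit` preserves it and `InPhase.valid` passes from
one phase to the next, which gives correctness. For the bound, the number of uncompleted commands
never grows, and by `InPhase.exists_progress` two visits can always lower it. -/

/-- The configuration congruent to `i` modulo three. -/
def color (i : ℕ) : Fin 3 := Fin.ofNat 3 i

lemma color_eq_iff {a b : ℕ} : color a = color b ↔ a % 3 = b % 3 := by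
  simp [color, Fin.ext_iff]

lemma color_mod (i : ℕ) : color (i % 3) = color i := by
  simp [color_eq_iff]

lemma rept_succ {C : Type} (m : ℕ) (B : List (Command C)) :
    rept (m + 1) B = B ++ rept m B := by
  simp [rept, List.replicate_succ]

lemma length_rept {C : Type} (m : ℕ) (B : List (Command C)) :
    (rept m B).length = m * B.length := by
  simp [rept]

lemma getElem?_rept {C : Type} (B : List (Command C)) (m i : ℕ) (h : i < m * B.length) :
    (rept m B)[i]? = B[i % B.length]? := by
  induction m generalizing i with
  | zero => simp at h
  | succ m ih =>
    rw [rept_succ]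
    by_cases hi : i < B.length
    · rw [List.getElem?_append_left hi, Nat.mod_eq_of_lt hi]
    · push Not at hi
      rw [List.getElem?_append_right hi, ih, Nat.mod_eq_sub_mod hi]
      rw [Nat.succ_mul] at h
      omega

lemma getElem?_append_add {α : Type} {l₁ l₂ : List α} {m : ℕ} (i : ℕ) (h : l₁.length = m) :
    (l₁ ++ l₂)[m + i]? = l₂[i]? := by
  rw [List.getElem?_append_right (by omega)]
  congr 1
  omega

lemma getElem?_append_of_eq_some {α : Type} {l₁ l₂ : List α} {i : ℕ} {a : α}
    (h : l₁[i]? = some a) : (l₁ ++ l₂)[i]? = some a := by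
  rw [List.getElem?_append_left (List.getElem?_eq_some_iff.1 h).1, h]

/-- The commands that a prisoner executes before his active phases. -/
lemma getElem?_rept_before {m i : ℕ} (h : i < 3 * m) :
    (rept m [Command.flip (1 : Fin 3) 0, .flip 2 1, .flip 0 2])[i]? =
      some (.flip (color (i + 1)) (color i)) := by
  rw [getElem?_rept _ _ _ (by simp; omega)]
  have h3 : i % 3 < 3 := Nat.mod_lt _ (by norm_num)
  rw [← color_mod i, ← color_mod (i + 1), Nat.add_mod]
  simp only [List.length_cons, List.length_nil, zero_add, Nat.reduceAdd]
  generalize i % 3 = j at *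
  interval_cases j <;> rfl

/-- The commands that a prisoner executes after his active phases. -/
lemma getElem?_rept_after {m i : ℕ} (h : i < 3 * m) :
    (rept m [Command.flip (2 : Fin 3) 1, .flip 0 2, .flip 1 0])[i]? =
      some (.flip (color (i + 2)) (color (i + 1))) := by
  rw [getElem?_rept _ _ _ (by simp; omega)]
  have h3 : i % 3 < 3 := Nat.mod_lt _ (by norm_num)
  rw [← color_mod (i + 2), ← color_mod (i + 1), Nat.add_mod i 2, Nat.add_mod i 1]
  simp only [List.length_cons, List.length_nil, zero_add, Nat.reduceAdd]
  generalize i % 3 = j at *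
  interval_cases j <;> rfl

lemma length_activePhases (n r : ℕ) : (activePhases n r).length = 3 * (n + r - 1) := by
  simp [activePhases, length_rept]
  omega

lemma getElem?_activePhases {n r φ q : ℕ} (hφ : φ < 3) (hq : q < n + r - 1) :
    (activePhases n r)[φ * (n + r - 1) + q]? = some (.flip (color φ) (color (φ + 1))) := by
  have key (c : Command (Fin 3)) : (rept (n + r - 1) [c])[q]? = some c := by
    rw [getElem?_rept _ _ _ (by simpa using hq)]
    simp [Nat.mod_one]
  unfold activePhases
  interval_cases φ
  · rw [List.append_assoc, zero_mul, zero_add]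
    exact getElem?_append_of_eq_some (key _)
  · rw [List.append_assoc, one_mul, getElem?_append_add _ (by simp [length_rept])]
    exact getElem?_append_of_eq_some (key _)
  · rw [getElem?_append_add _ (by simp [length_rept]; omega)]
    exact key _

/-- The program of the prisoner with index `j`, counted from zero. -/
def program (n r j : ℕ) : List (Command (Fin 3)) :=
  if j + 1 = 1 then firstProgram n r
  else if j + 1 = n then lastProgram n r
  else middleProgram n r (j + 1)

/-- The number of commands that precede the active phases of prisoner `j`. -/
def activeStart (j : ℕ) : ℕ := 3 * j + min j 1

lemma program_before {n r j i : ℕ} (hi : i < 3 * j) :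
    (program n r j)[i]? = some (.flip (color (i + 1)) (color i)) := by
  have h0 : j + 1 ≠ 1 := by omega
  rw [program, if_neg h0]
  split_ifs with h1
  · subst h1
    simp only [lastProgram, List.append_assoc]
    exact getElem?_append_of_eq_some (getElem?_rept_before (by simpa using hi))
  · simp only [middleProgram, List.append_assoc]
    exact getElem?_append_of_eq_some (getElem?_rept_before (by simpa using hi))

lemma program_see {n r j : ℕ} (hj : 0 < j) : (program n r j)[3 * j]? = some (.see 1) := by
  have h0 : j + 1 ≠ 1 := by omega
  rw [program, if_neg h0]
  split_ifs with h1
  · subst h1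
    simp only [lastProgram, List.append_assoc]
    rw [← add_zero (3 * j), getElem?_append_add _ (by simp [length_rept]; omega)]
    simp
  · simp only [middleProgram, List.append_assoc]
    rw [← add_zero (3 * j), getElem?_append_add _ (by simp [length_rept]; omega)]
    simp

/-- What a prisoner executes after his preliminary commands. -/
lemma program_drop {n r j : ℕ} (hn : 2 ≤ n) :
    ∃ pre, pre.length = activeStart j ∧ program n r j = pre ++ (activePhases n r ++
      if j + 1 = n then [.declare]
      else .oscillate 1 0 :: rept (n - 1 - j) [.flip 2 1, .flip 0 2, .flip 1 0]) := by
  unfold program activeStart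
  split_ifs with h0 h1 h1
  · omega
  · obtain rfl : j = 0 := by omega
    exact ⟨[], by simp, by simp [firstProgram]⟩
  · subst h1
    refine ⟨rept j [.flip 1 0, .flip 2 1, .flip 0 2] ++ [.see 1], ?_, by simp [lastProgram]⟩
    simp [length_rept]
    omega
  · refine ⟨rept j [.flip 1 0, .flip 2 1, .flip 0 2] ++ [.see 1], ?_, ?_⟩
    · simp [length_rept]
      omega
    · have : n - (j + 1) = n - 1 - j := by omega
      simp [middleProgram, this]

lemma program_active {n r j φ q : ℕ} (hn : 2 ≤ n) (hφ : φ < 3) (hq : q < n + r - 1) :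
    (program n r j)[activeStart j + φ * (n + r - 1) + q]? =
      some (.flip (color φ) (color (φ + 1))) := by
  obtain ⟨pre, hl, he⟩ := program_drop (r := r) (j := j) hn
  rw [he, add_assoc, getElem?_append_add _ hl]
  exact getElem?_append_of_eq_some (getElem?_activePhases hφ hq)

lemma program_declare {n r j : ℕ} (hn : 2 ≤ n) (hj : j + 1 = n) :
    (program n r j)[activeStart j + 3 * (n + r - 1)]? = some .declare := by
  obtain ⟨pre, hl, he⟩ := program_drop (r := r) (j := j) hn
  rw [he, getElem?_append_add _ hl, ← add_zero (3 * _),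
    getElem?_append_add _ (length_activePhases n r), if_pos hj]
  rfl

lemma program_oscillate {n r j : ℕ} (hn : 2 ≤ n) (hj : j + 1 < n) :
    (program n r j)[activeStart j + 3 * (n + r - 1)]? = some (.oscillate 1 0) := by
  obtain ⟨pre, hl, he⟩ := program_drop (r := r) (j := j) hn
  rw [he, getElem?_append_add _ hl, ← add_zero (3 * _),
    getElem?_append_add _ (length_activePhases n r), if_neg (by omega)]
  rfl

/-- The shift by one arises because OSCILLATE stands where a flip from `1` to `0` would be; with it,
each later active prisoner is again matched with three commands. -/
lemma program_after {n r j q : ℕ} (hn : 2 ≤ n) (hj : j + 1 < n) (hq : q < 3 * (n - 1 - j)) :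
    (program n r j)[activeStart j + 3 * (n + r - 1) + (q + 1)]? =
      some (.flip (color (q + 2)) (color (q + 1))) := by
  obtain ⟨pre, hl, he⟩ := program_drop (r := r) (j := j) hn
  rw [he, add_assoc, getElem?_append_add _ hl,
    getElem?_append_add _ (length_activePhases n r), if_neg (by omega), List.getElem?_cons_succ]
  exact getElem?_rept_after hq

/-! ### Executing a single command -/

section Execution

variable {C : Type} [DecidableEq C] {l : List (Command C)} {i : ℕ} {a b c : C} {z : ℤ}

lemma drop_eq_cons_of_getElem? {α : Type} {l : List α} {i : ℕ} {a : α} (h : l[i]? = some a) :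
    l.drop i = a :: l.drop (i + 1) := by
  obtain ⟨hi, rfl⟩ := List.getElem?_eq_some_iff.1 h
  exact List.drop_eq_getElem_cons hi

lemma act_flip (h : l[i]? = some (.flip a b)) :
    ProgramState.act ⟨l.drop i, z⟩ c =
      if c = a then (⟨l.drop (i + 1), 0⟩, b) else (⟨l.drop i, z⟩, c) := by
  rw [drop_eq_cons_of_getElem? h]
  rfl

lemma act_see (h : l[i]? = some (.see a)) :
    ProgramState.act ⟨l.drop i, z⟩ c =
      if c = a then (⟨l.drop (i + 1), 0⟩, c) else (⟨l.drop i, z⟩, c) := by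
  rw [drop_eq_cons_of_getElem? h]
  rfl

lemma act_oscillate (h : l[i]? = some (.oscillate a b)) :
    ProgramState.act ⟨l.drop i, z⟩ c =
      if c = a then
        if 0 < z + 1 then (⟨l.drop (i + 1), 0⟩, b) else (⟨l.drop i, z + 1⟩, b)
      else if c = b then (⟨l.drop i, z - 1⟩, a)
      else (⟨l.drop i, z⟩, c) := by
  rw [drop_eq_cons_of_getElem? h]
  rfl

lemma act_declare (s : ProgramState C) (h : s.todo.head? = some .declare) :
    s.act c = (s, c) := by
  obtain ⟨t, z⟩ := s
  cases t with
  | nil => simp at h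
  | cons d t =>
    obtain rfl : d = .declare := by simpa using h
    rfl

lemma length_todo_act_le (s : ProgramState C) (c : C) :
    (s.act c).1.todo.length ≤ s.todo.length := by
  obtain ⟨t, z⟩ := s
  cases t with
  | nil => simp [ProgramState.act]
  | cons d t =>
    cases d <;> simp only [ProgramState.act] <;> (try split_ifs) <;> simp

end Execution

/-! ### The invariant -/

/-- The state `s`, reached by the visits `w`, belongs to phase `φ` of active prisoner `k`, who has
made `q` of the `n + r - 1` flips of this phase. Room `x` has configuration `φ + T x`; each other
prisoner `j` holds a virtual room of configuration `φ + β j`. The current command of prisoner `j`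
has position `pos j` in the program, and balance `bal j`. -/
structure InPhase (n r : ℕ) (k φ q : ℕ) (T : Fin r → ℤ) (β : Fin n → ℤ) (pos : Fin n → ℕ)
    (bal : Fin n → ℤ) (s : GameState (oscillatingProtocol n r) r)
    (w : List (Fin n × Fin r)) : Prop where
  k_lt : k < n
  phase_lt : φ < 3
  flips_le : q ≤ n + r - 1
  room_bit : ∀ x, T x = 0 ∨ T x = 1
  held_bit : ∀ j, β j = 0 ∨ β j = 1
  room_eq : ∀ x, s.room x = color (φ + (T x).toNat)
  memory_eq : ∀ j, s.memory j = ⟨(program n r j).drop (pos j), bal j⟩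
  -- One command per completed phase, three per completed active prisoner, and one more if the
  -- exchange of this phase has been made.
  later : ∀ j : Fin n, k < j → (pos j : ℤ) = 3 * k + φ + β j
  earlier : ∀ j : Fin n, (j : ℕ) < k →
    (pos j : ℤ) = (activeStart j + 3 * (n + r - 1) : ℕ) + (3 * (k - j - 1) + φ + β j)
  active : ∀ j : Fin n, (j : ℕ) = k → β j = 0 ∧
    (pos j = activeStart j + φ * (n + r - 1) + q ∨ φ = 0 ∧ q = 0 ∧ 0 < k ∧ pos j = 3 * k)
  -- Only the previous active prisoner can be oscillating, and only in the 0-phase before his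
  -- exchange.
  balance : ∀ j : Fin n, bal j = 0 ∨ bal j < 0 ∧ (j : ℕ) + 1 = k ∧ φ = 0 ∧ β j = 0
  count : (q : ℤ) = ∑ x, T x + ∑ j, (β j + bal j)
  visited_earlier : ∀ j : Fin n, (j : ℕ) < k → ∀ x, (j, x) ∈ w
  -- The analogue for the 0-phase would fail, since there the oscillating prisoner also puts `1`
  -- into rooms.
  visited_one : φ = 1 → ∀ x, T x = 1 → ∀ j : Fin n, (j : ℕ) = k → (j, x) ∈ w
  visited_two : φ = 2 → ∀ j : Fin n, (j : ℕ) = k → ∀ x, (j, x) ∈ w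

variable {n r k φ q : ℕ} {T : Fin r → ℤ} {β : Fin n → ℤ} {pos : Fin n → ℕ} {bal : Fin n → ℤ}
  {s : GameState (oscillatingProtocol n r) r} {w : List (Fin n × Fin r)}

lemma sum_update_eq {ι : Type} [Fintype ι] [DecidableEq ι] (f : ι → ℤ) (i : ι) (a : ℤ) :
    ∑ j, Function.update f i a j = ∑ j, f j + (a - f i) := by
  rw [Finset.sum_update_of_mem (Finset.mem_univ i),
    ← Finset.add_sum_erase _ f (Finset.mem_univ i), Finset.sdiff_singleton_eq_erase]
  ring

lemma visit_room (p : Fin n) (x : Fin r) {m : ProgramState (Fin 3)} {c : Fin 3}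
    (h : ProgramState.act (s.memory p) (s.room x) = (m, c)) :
    ((oscillatingProtocol n r).visit s (p, x)).room = Function.update s.room x c := by
  have : c = (ProgramState.act (s.memory p) (s.room x)).2 := by rw [h]
  rw [this]
  rfl

lemma visit_memory_self (p : Fin n) (x : Fin r) :
    ((oscillatingProtocol n r).visit s (p, x)).memory p =
      (ProgramState.act (s.memory p) (s.room x)).1 :=
  Function.update_self ..

lemma visit_memory_of_ne {p j : Fin n} (x : Fin r) (h : j ≠ p) :
    ((oscillatingProtocol n r).visit s (p, x)).memory j = s.memory j :=
  Function.update_of_ne h ..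

/-- The effect of a visit on the parameters of the invariant. -/
lemma InPhase.visit (h : InPhase n r k φ q T β pos bal s w) (p : Fin n) (x : Fin r)
    (q' : ℕ) (t b z : ℤ) (i : ℕ)
    (hact : ProgramState.act ⟨(program n r p).drop (pos p), bal p⟩ (color (φ + (T x).toNat)) =
      (⟨(program n r p).drop i, z⟩, color (φ + t.toNat)))
    (hq : q' ≤ n + r - 1) (ht : t = 0 ∨ t = 1) (hb : b = 0 ∨ b = 1)
    (hqp : (p : ℕ) ≠ k → q' = q)
    (later : k < p → (i : ℤ) = 3 * k + φ + b)
    (earlier : (p : ℕ) < k →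
      (i : ℤ) = (activeStart p + 3 * (n + r - 1) : ℕ) + (3 * (k - p - 1) + φ + b))
    (active : (p : ℕ) = k → b = 0 ∧
      (i = activeStart p + φ * (n + r - 1) + q' ∨ φ = 0 ∧ q' = 0 ∧ 0 < k ∧ i = 3 * k))
    (balance : z = 0 ∨ z < 0 ∧ (p : ℕ) + 1 = k ∧ φ = 0 ∧ b = 0)
    (count : (q' : ℤ) = q + (t - T x) + (b - β p) + (z - bal p))
    (visited : φ = 1 → t = 1 → T x = 1 ∨ (p : ℕ) = k) :
    InPhase n r k φ q' (Function.update T x t) (Function.update β p b) (Function.update pos p i)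
      (Function.update bal p z) ((oscillatingProtocol n r).visit s (p, x)) (w ++ [(p, x)]) := by
  have hact' : ProgramState.act (s.memory p) (s.room x) =
      (⟨(program n r p).drop i, z⟩, color (φ + t.toNat)) := by
    rw [h.room_eq x, ← hact]
    exact congrArg (fun m : ProgramState (Fin 3) => m.act _) (h.memory_eq p)
  refine ⟨h.k_lt, h.phase_lt, hq, ?_, ?_, ?_, ?_, ?_, ?_, ?_, ?_, ?_, ?_, ?_, ?_⟩
  · intro y
    by_cases hy : y = x
    · subst hy; simpa using ht
    · simpa [hy] using h.room_bit y
  · intro j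
    by_cases hj : j = p
    · subst hj; simpa using hb
    · simpa [hj] using h.held_bit j
  · intro y
    rw [visit_room p x hact']
    by_cases hy : y = x
    · subst hy; simp
    · simpa [hy] using h.room_eq y
  · intro j
    by_cases hj : j = p
    · subst hj
      rw [visit_memory_self, Function.update_self, Function.update_self]
      exact congrArg Prod.fst hact'
    · rw [visit_memory_of_ne x hj, Function.update_of_ne hj, Function.update_of_ne hj]
      exact h.memory_eq j
  · intro j
    by_cases hj : j = p
    · subst hj; simpa using later
    · simpa [hj] using h.later j
  · intro j
    by_cases hj : j = p
    · subst hj; simpa using earlier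
    · simpa [hj] using h.earlier j
  · intro j hjk
    by_cases hj : j = p
    · subst hj; simpa using active hjk
    · have hpk : (p : ℕ) ≠ k := fun e => hj (Fin.ext (hjk.trans e.symm))
      rw [hqp hpk]
      simpa [hj] using h.active j hjk
  · intro j
    by_cases hj : j = p
    · subst hj; simpa using balance
    · simpa [hj] using h.balance j
  · have hc := h.count
    rw [Finset.sum_add_distrib] at hc ⊢
    rw [sum_update_eq, sum_update_eq, sum_update_eq]
    linarith
  · intro j hj y
    exact List.mem_append_left _ (h.visited_earlier j hj y)
  · intro hφ y hy j hj
    by_cases hyx : y = x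
    · subst hyx
      rcases visited hφ (by simpa using hy) with h1 | h1
      · exact List.mem_append_left _ (h.visited_one hφ y h1 j hj)
      · obtain rfl : j = p := Fin.ext (hj.trans h1.symm)
        simp
    · exact List.mem_append_left _ (h.visited_one hφ y (by simpa [hyx] using hy) j hj)
  · intro hφ j hj y
    exact List.mem_append_left _ (h.visited_two hφ j hj y)

/-- A visit at which the prisoner waits preserves the invariant. -/
lemma InPhase.visit_wait (h : InPhase n r k φ q T β pos bal s w) (p : Fin n) (x : Fin r)
    (hact : ProgramState.act ⟨(program n r p).drop (pos p), bal p⟩ (color (φ + (T x).toNat)) =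
      (⟨(program n r p).drop (pos p), bal p⟩, color (φ + (T x).toNat))) :
    InPhase n r k φ q T β pos bal ((oscillatingProtocol n r).visit s (p, x)) (w ++ [(p, x)]) := by
  have := h.visit p x q (T x) (β p) (bal p) (pos p) hact h.flips_le (h.room_bit x) (h.held_bit p)
    (fun _ => rfl) (h.later p) (h.earlier p) (h.active p) (h.balance p) (by ring)
    (fun _ h1 => Or.inl h1)
  simpa using this

/-- The current command of a prisoner who is not active. -/
lemma InPhase.command_passive (hn : 2 ≤ n) (h : InPhase n r k φ q T β pos bal s w) (p : Fin n)
    (hp : (p : ℕ) ≠ k) :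
    ((program n r p)[pos p]? =
        some (.flip (color (φ + 1 + (β p).toNat)) (color (φ + (β p).toNat))) ∧ bal p = 0) ∨
    ((program n r p)[pos p]? = some (.see (color 1)) ∧ φ = 2 ∧ β p = 1) ∨
    ((program n r p)[pos p]? = some (.oscillate (color 1) (color 0)) ∧ φ = 0 ∧ β p = 0 ∧ (p : ℕ) + 1 = k) := by
  have hb := h.held_bit p
  have hφ := h.phase_lt
  have hk := h.k_lt
  have hbal := h.balance p
  rcases lt_or_gt_of_ne hp with hlt | hgt
  · have hpos := h.earlier p hlt
    obtain ⟨d, hd⟩ : ∃ d : ℕ, d = 3 * (k - p - 1) + φ + (β p).toNat := ⟨_, rfl⟩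
    have hpos' : pos p = activeStart p + 3 * (n + r - 1) + d := by omega
    -- Offset `0` is OSCILLATE, reached only for the immediate predecessor of the active prisoner,
    -- in the 0-phase before his exchange.
    rcases Nat.eq_zero_or_pos d with h0 | h0
    · refine Or.inr (Or.inr ⟨?_, by omega, by omega, by omega⟩)
      rw [hpos', h0, add_zero]
      exact program_oscillate hn (by omega)
    · obtain ⟨e, rfl⟩ : ∃ e, d = e + 1 := ⟨d - 1, by omega⟩
      refine Or.inl ⟨?_, by omega⟩
      rw [hpos', program_after hn (by omega) (by omega)]
      have h1 : color (e + 2) = color (φ + 1 + (β p).toNat) := color_eq_iff.2 (by omega)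
      have h2 : color (e + 1) = color (φ + (β p).toNat) := color_eq_iff.2 (by omega)
      rw [h1, h2]
  · have hpos := h.later p hgt
    -- Since `β p ≤ 1` and `φ ≤ 2`, only the immediate successor can stand at SEE, having made his
    -- exchange in the 2-phase.
    by_cases h3 : pos p = 3 * p
    · refine Or.inr (Or.inl ⟨?_, by omega, by omega⟩)
      rw [h3]
      exact program_see (by omega)
    · refine Or.inl ⟨?_, by omega⟩
      rw [program_before (by omega)]
      have h1 : color (pos p + 1) = color (φ + 1 + (β p).toNat) := color_eq_iff.2 (by omega)
      have h2 : color (pos p) = color (φ + (β p).toNat) := color_eq_iff.2 (by omega)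
      rw [h1, h2]

lemma color_ne {a b : ℕ} (h : a % 3 ≠ b % 3) : color a ≠ color b := fun e => h (color_eq_iff.1 e)

/-- A passive prisoner exchanges the held configuration with that of a room. -/
lemma InPhase.visit_exchange (h : InPhase n r k φ q T β pos bal s w) (p : Fin n)
    (x : Fin r) (hp : (p : ℕ) ≠ k) (hT : T x = 1) (hβ : β p = 0) (hbal : bal p = 0)
    (hc : (program n r p)[pos p]? = some (.flip (color (φ + 1)) (color φ)) ∨
      (program n r p)[pos p]? = some (.oscillate (color 1) (color 0)) ∧ φ = 0) :
    InPhase n r k φ q (Function.update T x 0) (Function.update β p 1)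
      (Function.update pos p (pos p + 1)) (Function.update bal p 0)
      ((oscillatingProtocol n r).visit s (p, x)) (w ++ [(p, x)]) := by
  refine h.visit p x q 0 1 0 (pos p + 1) ?_ h.flips_le (by simp) (by simp) (fun _ => rfl)
    ?_ ?_ ?_ (by simp) ?_ (by simp)
  · rcases hc with hc | ⟨hc, rfl⟩
    · rw [act_flip hc, hT]
      simp
    -- At balance `0`, seeing a `1` completes OSCILLATE at once, so it acts like a flip from `1` to
    -- `0`.
    · rw [act_oscillate hc, hT, hbal]
      simp
  · intro hk
    have := h.later p hk
    push_cast
    omega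
  · intro hk
    have := h.earlier p hk
    push_cast at this ⊢
    omega
  · exact fun e => absurd e hp
  · rw [hT, hβ, hbal]
    ring

/-- The active prisoner flips a room. -/
lemma InPhase.visit_flip (hn : 2 ≤ n) (h : InPhase n r k φ q T β pos bal s w)
    (hq : q < n + r - 1) {p : Fin n} {x : Fin r} (hp : (p : ℕ) = k)
    (hpos : pos p = activeStart p + φ * (n + r - 1) + q) (hT : T x = 0) :
    InPhase n r k φ (q + 1) (Function.update T x 1) (Function.update β p 0)
      (Function.update pos p (pos p + 1)) (Function.update bal p 0)
      ((oscillatingProtocol n r).visit s (p, x)) (w ++ [(p, x)]) := by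
  have hbal := h.balance p
  have hβ := (h.active p hp).1
  refine h.visit p x (q + 1) 1 0 0 (pos p + 1) ?_ hq (by simp) (by simp)
    (fun e => absurd hp e) (by omega) (by omega) (fun _ => ⟨rfl, Or.inl (by omega)⟩) (by simp) ?_
    (fun _ _ => Or.inr hp)
  · have hc := program_active (j := p) hn h.phase_lt hq
    rw [← hpos] at hc
    rw [act_flip hc, hT]
    simp
  · rw [hT, hβ]
    push_cast
    omega

/-- The active prisoner sees the signal to start. -/
lemma InPhase.visit_see (h : InPhase n r k 0 0 T β pos bal s w) {p : Fin n} {x : Fin r}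
    (hp : (p : ℕ) = k) (hk : 0 < k) (hpos : pos p = 3 * k) (hT : T x = 1) :
    InPhase n r k 0 0 (Function.update T x 1) (Function.update β p 0)
      (Function.update pos p (pos p + 1)) (Function.update bal p 0)
      ((oscillatingProtocol n r).visit s (p, x)) (w ++ [(p, x)]) := by
  have hbal := h.balance p
  have hβ := (h.active p hp).1
  refine h.visit p x 0 1 0 0 (pos p + 1) ?_ (Nat.zero_le _) (by simp) (by simp)
    (fun _ => rfl) (by omega) (by omega) (fun _ => ⟨rfl, Or.inl ?_⟩) (by simp) ?_
    (fun _ _ => Or.inr hp)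
  · have hc : (program n r p)[3 * (p : ℕ)]? = some (.see (color 1)) := program_see (by omega)
    rw [hp, ← hpos, ← hp] at hc
    rw [act_see hc, hT]
    simp
  · unfold activeStart
    omega
  · rw [hT, hβ]
    push_cast
    omega

/-- The previous active prisoner turns a room from `1` to `0` and continues to oscillate. -/
lemma InPhase.visit_oscillate_down (h : InPhase n r k 0 q T β pos bal s w) {p : Fin n}
    {x : Fin r} (hp : (p : ℕ) + 1 = k) (hβ : β p = 0) (hbal : bal p < 0) (hT : T x = 1)
    (hc : (program n r p)[pos p]? = some (.oscillate (color 1) (color 0))) :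
    InPhase n r k 0 q (Function.update T x 0) β pos (Function.update bal p (bal p + 1))
      ((oscillatingProtocol n r).visit s (p, x)) (w ++ [(p, x)]) := by
  have := h.visit p x q 0 (β p) (bal p + 1) (pos p) (by
      -- The new balance `bal p + 1` is at most `0`, so the command is not yet complete.
      rw [act_oscillate hc, hT, if_pos (by simp), if_neg (by omega)]
      simp) h.flips_le (by simp) (h.held_bit p)
    (fun _ => rfl) (h.later p) (h.earlier p) (h.active p) (by omega) (by rw [hT]; ring)
    (by simp)
  simpa using this

/-- The previous active prisoner turns a room from `0` to `1`. -/
lemma InPhase.visit_oscillate_up (h : InPhase n r k 0 q T β pos bal s w) {p : Fin n}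
    {x : Fin r} (hp : (p : ℕ) + 1 = k) (hβ : β p = 0) (hT : T x = 0)
    (hc : (program n r p)[pos p]? = some (.oscillate (color 1) (color 0))) :
    InPhase n r k 0 q (Function.update T x 1) β pos (Function.update bal p (bal p - 1))
      ((oscillatingProtocol n r).visit s (p, x)) (w ++ [(p, x)]) := by
  have hbal := h.balance p
  have := h.visit p x q 1 (β p) (bal p - 1) (pos p) (by
      rw [act_oscillate hc, hT, if_neg (color_ne (by simp)), if_pos (by simp)]
      simp) h.flips_le (by simp) (h.held_bit p)
    (fun _ => rfl) (h.later p) (h.earlier p) (h.active p) (by omega) (by rw [hT]; ring)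
    (by simp)
  simpa using this

/-- Visits preserve the invariant. -/
lemma InPhase.exists_visit (hn : 2 ≤ n) (h : InPhase n r k φ q T β pos bal s w)
    (hq : q < n + r - 1) (p : Fin n) (x : Fin r) :
    ∃ q' T' β' pos' bal', InPhase n r k φ q' T' β' pos' bal'
      ((oscillatingProtocol n r).visit s (p, x)) (w ++ [(p, x)]) := by
  have hT := h.room_bit x
  have hφ := h.phase_lt
  by_cases hp : (p : ℕ) = k
  · obtain ⟨hβ, hpos | ⟨rfl, rfl, hk, hpos⟩⟩ := h.active p hp
    · rcases hT with hT | hT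
      · exact ⟨_, _, _, _, _, h.visit_flip hn hq hp hpos hT⟩
      · refine ⟨_, _, _, _, _, h.visit_wait p x ?_⟩
        have hc := program_active (j := p) hn h.phase_lt hq
        rw [← hpos] at hc
        rw [act_flip hc, if_neg (color_ne (by omega))]
    · rcases hT with hT | hT
      · refine ⟨_, _, _, _, _, h.visit_wait p x ?_⟩
        have hc : (program n r p)[3 * (p : ℕ)]? = some (.see (color 1)) := program_see (by omega)
        rw [hp, ← hpos, ← hp] at hc
        rw [act_see hc, if_neg (color_ne (by omega))]
      · exact ⟨_, _, _, _, _, h.visit_see hp hk hpos hT⟩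
  · have hb := h.held_bit p
    have hbal := h.balance p
    rcases h.command_passive hn p hp with ⟨hc, hz⟩ | ⟨hc, rfl, hβ⟩ | ⟨hc, rfl, hβ, hk⟩
    · by_cases hx : T x = 1 ∧ β p = 0
      · refine ⟨_, _, _, _, _, h.visit_exchange p x hp hx.1 hx.2 hz (Or.inl ?_)⟩
        simpa [hx.2] using hc
      · refine ⟨_, _, _, _, _, h.visit_wait p x ?_⟩
        -- He waits either for `φ + 1` in a room that has `φ`, or, after his exchange, for `φ + 2`,
        -- which no room has in this phase.
        rw [act_flip hc, if_neg (color_ne (by omega))]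
    · refine ⟨_, _, _, _, _, h.visit_wait p x ?_⟩
      -- In the 2-phase rooms have configuration `2` or `0`, so SEE cannot be triggered too early.
      rw [act_see hc, if_neg (color_ne (by omega))]
    · rcases hT with hT | hT
      · exact ⟨_, _, _, _, _, h.visit_oscillate_up hk hβ hT hc⟩
      · by_cases hz : bal p = 0
        · exact ⟨_, _, _, _, _, h.visit_exchange p x hp hT hβ hz (Or.inr ⟨hc, rfl⟩)⟩
        · exact ⟨_, _, _, _, _, h.visit_oscillate_down hk hβ (by omega) hT hc⟩

/-! ### Passing to the next phase -/

lemma sum_not_active (hk : k < n) :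
    ∑ j : Fin n, (if (j : ℕ) = k then (0 : ℤ) else 1) = n - 1 := by
  have h (j : Fin n) : (if (j : ℕ) = k then (0 : ℤ) else 1) = 1 - if j = ⟨k, hk⟩ then 1 else 0 := by
    by_cases hj : (j : ℕ) = k <;> simp [Fin.ext_iff, hj]
  simp_rw [h, Finset.sum_sub_distrib]
  simp

/-- The number of flips that remain counts the rooms and passive prisoners still to be changed. -/
lemma InPhase.sum_remaining (h : InPhase n r k φ q T β pos bal s w) :
    ∑ x, (1 - T x) + ∑ j : Fin n, ((if (j : ℕ) = k then 0 else 1) - (β j + bal j)) =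
      (n : ℤ) + r - 1 - q := by
  rw [Finset.sum_sub_distrib, Finset.sum_sub_distrib, sum_not_active h.k_lt, h.count]
  simp
  ring

/-- At the end of a phase everything has been changed. -/
lemma InPhase.all_changed (h : InPhase n r k φ q T β pos bal s w) (hr : 1 ≤ r)
    (hq : q = n + r - 1) :
    (∀ x, T x = 1) ∧ ∀ j : Fin n, bal j = 0 ∧ ((j : ℕ) ≠ k → β j = 1) := by
  have hs := h.sum_remaining
  have hx : ∀ x ∈ Finset.univ, 0 ≤ 1 - T x := fun x _ => by
    have := h.room_bit x
    omega
  have hj : ∀ j ∈ Finset.univ (α := Fin n),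
      0 ≤ (if (j : ℕ) = k then 0 else 1) - (β j + bal j) := fun j _ => by
    have h1 := h.held_bit j
    have h2 := h.balance j
    have h3 := h.active j
    split_ifs <;> omega
  have h0 : ∑ x, (1 - T x) = 0 ∧
      ∑ j : Fin n, ((if (j : ℕ) = k then 0 else 1) - (β j + bal j)) = 0 := by
    have h1 := Finset.sum_nonneg hx
    have h2 := Finset.sum_nonneg hj
    omega
  refine ⟨fun x => ?_, fun j => ?_⟩
  · have := (Finset.sum_eq_zero_iff_of_nonneg hx).1 h0.1 x (Finset.mem_univ x)
    omega
  · have h4 := (Finset.sum_eq_zero_iff_of_nonneg hj).1 h0.2 j (Finset.mem_univ j)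
    have h1 := h.held_bit j
    have h2 := h.balance j
    have h3 := h.active j
    split_ifs at h4 <;> omega

/-- The last prisoner has declared, and everyone has been in every room. -/
def Finished (s : GameState (oscillatingProtocol n r) r) (w : List (Fin n × Fin r)) : Prop :=
  (∀ (p : Fin n) (x : Fin r), (p, x) ∈ w) ∧
    ∃ p, (oscillatingProtocol n r).Declares p (s.memory p)

/-- The states that are reached. -/
def Valid (s : GameState (oscillatingProtocol n r) r) (w : List (Fin n × Fin r)) : Prop :=
  Finished s w ∨ ∃ k φ q T β pos bal, q < n + r - 1 ∧ InPhase n r k φ q T β pos bal s w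

/-- A completed phase is the next phase with no flips made: all bits drop from `1` to `0` while `φ`
grows by one, and no program position moves. After the 2-phase the configurations wrap around to `0`
and the role of active prisoner passes on, or the last prisoner has reached DECLARE. -/
lemma InPhase.valid (hn : 2 ≤ n) (hr : 1 ≤ r) (h : InPhase n r k φ q T β pos bal s w) :
    Valid s w := by
  rcases h.flips_le.lt_or_eq with hq | hq
  · exact Or.inr ⟨k, φ, q, T, β, pos, bal, hq, h⟩
  obtain ⟨hT, hj⟩ := h.all_changed hr hq
  have hφ := h.phase_lt
  have hk := h.k_lt
  have hpos (j : Fin n) (hjk : (j : ℕ) = k) :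
      pos j = activeStart j + (φ + 1) * (n + r - 1) := by
    have := h.active j hjk
    rw [Nat.succ_mul]
    omega
  have hroom (x : Fin r) : s.room x = color (φ + 1) := by
    rw [h.room_eq x, hT x]
    rfl
  by_cases h2 : φ = 2
  · subst h2
    have hvis : ∀ j : Fin n, (j : ℕ) < k + 1 → ∀ x, (j, x) ∈ w := fun j hjk x => by
      rcases Nat.lt_succ_iff_lt_or_eq.1 hjk with hjk | hjk
      · exact h.visited_earlier j hjk x
      · exact h.visited_two rfl j hjk x
    by_cases hkn : k + 1 = n
    · refine Or.inl ⟨fun p x => hvis p (by omega) x, ⟨k, hk⟩, ?_⟩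
      change (s.memory ⟨k, hk⟩).todo.head? = some .declare
      rw [h.memory_eq, List.head?_drop, hpos _ rfl]
      exact program_declare hn hkn
    · refine Or.inr ⟨k + 1, 0, 0, fun _ => 0, fun _ => 0, pos, fun _ => 0, by omega,
        by omega, by omega, by omega, by simp, by simp, ?_, ?_, ?_, ?_, ?_, by simp, by simp,
        hvis, by simp, by simp⟩
      · intro x
        rw [hroom x]
        rfl
      · intro j
        rw [h.memory_eq j, (hj j).1]
      · intro j hjk
        have h1 := h.later j (by omega)
        have h2 := (hj j).2 (by omega)
        push_cast at h1 ⊢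
        omega
      · intro j hjk
        by_cases hjk' : (j : ℕ) = k
        · have := hpos j hjk'
          push_cast at this ⊢
          omega
        · have h1 := h.earlier j (by omega)
          have h2 := (hj j).2 hjk'
          push_cast at h1 ⊢
          omega
      · intro j hjk
        have h1 := h.later j (by omega)
        have h2 := (hj j).2 (by omega)
        -- The new active prisoner is at `3 * k + 2 + 1 = 3 * (k + 1)`, his SEE command.
        exact ⟨rfl, Or.inr ⟨rfl, rfl, by omega, by omega⟩⟩
  · refine Or.inr ⟨k, φ + 1, 0, fun _ => 0, fun _ => 0, pos, fun _ => 0, by omega,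
      by omega, by omega, by omega, by simp, by simp, ?_, ?_, ?_, ?_, ?_, by simp, by simp,
      h.visited_earlier, by simp, ?_⟩
    · intro x
      rw [hroom x]
      rfl
    · intro j
      rw [h.memory_eq j, (hj j).1]
    · intro j hjk
      have h1 := h.later j hjk
      have h2 := (hj j).2 (by omega)
      push_cast at h1 ⊢
      omega
    · intro j hjk
      have h1 := h.earlier j hjk
      have h2 := (hj j).2 (by omega)
      push_cast at h1 ⊢
      omega
    · intro j hjk
      exact ⟨rfl, Or.inl (hpos j hjk)⟩
    · intro hφ' j hjk x
      -- At the end of the 1-phase every room has been advanced, hence visited by the active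
      -- prisoner.
      exact h.visited_one (by omega) x (hT x) j hjk

lemma InPhase.not_declares (hn : 2 ≤ n) (h : InPhase n r k φ q T β pos bal s w)
    (hq : q < n + r - 1) (p : Fin n) : ¬ (oscillatingProtocol n r).Declares p (s.memory p) := by
  change (s.memory p).todo.head? ≠ some .declare
  rw [h.memory_eq, List.head?_drop]
  by_cases hp : (p : ℕ) = k
  · obtain ⟨-, hpos | ⟨rfl, rfl, hk, hpos⟩⟩ := h.active p hp
    · rw [hpos, program_active hn h.phase_lt hq]
      simp
    · rw [hpos, ← hp, program_see (by omega)]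
      simp
  · rcases h.command_passive hn p hp with ⟨hc, -⟩ | ⟨hc, -⟩ | ⟨hc, -⟩ <;> rw [hc] <;> simp

/-- DECLARE is never removed from a program, so a declaration persists under further visits. -/
lemma Finished.visit (h : Finished s w) (v : Fin n × Fin r) :
    Finished ((oscillatingProtocol n r).visit s v) (w ++ [v]) := by
  obtain ⟨hw, p, hp⟩ := h
  refine ⟨fun p x => List.mem_append_left _ (hw p x), p, ?_⟩
  obtain ⟨p', x⟩ := v
  by_cases e : p = p'
  · subst e
    rw [visit_memory_self, act_declare _ hp]
    exact hp
  · rwa [visit_memory_of_ne x e]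

lemma Valid.visit (hn : 2 ≤ n) (hr : 1 ≤ r) (h : Valid s w) (v : Fin n × Fin r) :
    Valid ((oscillatingProtocol n r).visit s v) (w ++ [v]) := by
  rcases h with h | ⟨k, φ, q, T, β, pos, bal, hq, h⟩
  · exact Or.inl (h.visit v)
  · obtain ⟨_, _, _, _, _, h'⟩ := h.exists_visit hn hq v.1 v.2
    exact h'.valid hn hr

lemma run_append_singleton {n r : ℕ} {C : Type} (P : Protocol n C) (c₀ : Fin r → C)
    (w : List (Fin n × Fin r)) (v : Fin n × Fin r) :
    P.run c₀ (w ++ [v]) = P.visit (P.run c₀ w) v := by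
  simp [Protocol.run]

lemma valid_run (hn : 2 ≤ n) (hr : 1 ≤ r) (w : List (Fin n × Fin r)) :
    Valid ((oscillatingProtocol n r).run (fun _ => 0) w) w := by
  induction w using List.reverseRecOn with
  | nil =>
    refine Or.inr ⟨0, 0, 0, fun _ => 0, fun _ => 0, fun _ => 0, fun _ => 0, by omega,
      by omega, by omega, by omega, by simp, by simp, fun _ => rfl, fun _ => rfl, ?_, by simp,
      ?_, by simp, by simp, by simp, by simp, by simp⟩
    · simp
    · intro j hj
      -- The first prisoner has no SEE, so his active phases start at position `0`.
      simp [activeStart, hj]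
  | append_singleton w v ih =>
    rw [run_append_singleton]
    exact ih.visit hn hr v
/-! ### Progress -/

/-- The total number of commands that are not completed. -/
def commandsLeft (s : GameState (oscillatingProtocol n r) r) : ℕ :=
  ∑ p, (ProgramState.todo (s.memory p)).length

lemma length_todo_visit_le (s : GameState (oscillatingProtocol n r) r) (v : Fin n × Fin r)
    (p : Fin n) :
    (ProgramState.todo (((oscillatingProtocol n r).visit s v).memory p)).length ≤
      (ProgramState.todo (s.memory p)).length := by
  obtain ⟨p', x⟩ := v
  by_cases e : p = p'
  · subst e
    rw [visit_memory_self]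
    exact length_todo_act_le _ _
  · rw [visit_memory_of_ne x e]

lemma commandsLeft_visit_le (s : GameState (oscillatingProtocol n r) r) (v : Fin n × Fin r) :
    commandsLeft ((oscillatingProtocol n r).visit s v) ≤ commandsLeft s :=
  Finset.sum_le_sum fun p _ => length_todo_visit_le s v p

lemma commandsLeft_run_le (w : List (Fin n × Fin r)) (c₀ : Fin r → Fin 3) :
    commandsLeft ((oscillatingProtocol n r).run c₀ w) ≤
      commandsLeft ((oscillatingProtocol n r).initial c₀) := by
  induction w using List.reverseRecOn with
  | nil => exact le_rfl
  | append_singleton w v ih =>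
    rw [run_append_singleton]
    exact (commandsLeft_visit_le _ _).trans ih

/-- A visit at which a command is completed. -/
lemma InPhase.commandsLeft_visit_lt (h : InPhase n r k φ q T β pos bal s w) {p : Fin n}
    {x : Fin r} {c : Command (Fin 3)} (hc : (program n r p)[pos p]? = some c)
    {k' φ' q' : ℕ} {T' : Fin r → ℤ} {β' bal' : Fin n → ℤ} {pos' : Fin n → ℕ}
    {w' : List (Fin n × Fin r)}
    (h' : InPhase n r k' φ' q' T' β' (Function.update pos' p (pos p + 1)) bal'
      ((oscillatingProtocol n r).visit s (p, x)) w') :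
    commandsLeft ((oscillatingProtocol n r).visit s (p, x)) < commandsLeft s := by
  refine Finset.sum_lt_sum (fun j _ => length_todo_visit_le s _ j) ⟨p, Finset.mem_univ p, ?_⟩
  rw [h.memory_eq p, h'.memory_eq p, Function.update_self]
  have := (List.getElem?_eq_some_iff.1 hc).1
  simp only [List.length_drop]
  omega

/-- The active prisoner can complete a command. -/
lemma InPhase.progress_active (hn : 2 ≤ n) (h : InPhase n r k φ q T β pos bal s w)
    (hq : q < n + r - 1) {p : Fin n} {x : Fin r} (hp : (p : ℕ) = k)
    (hx : pos p = activeStart p + φ * (n + r - 1) + q ∧ T x = 0 ∨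
      φ = 0 ∧ q = 0 ∧ 0 < k ∧ pos p = 3 * k ∧ T x = 1) :
    commandsLeft ((oscillatingProtocol n r).visit s (p, x)) < commandsLeft s := by
  rcases hx with ⟨hpos, hT⟩ | ⟨rfl, rfl, hk, hpos, hT⟩
  · have hc := program_active (j := p) hn h.phase_lt hq
    rw [← hpos] at hc
    exact h.commandsLeft_visit_lt hc (h.visit_flip hn hq hp hpos hT)
  · have hc := program_see (n := n) (r := r) (j := p) (by omega)
    rw [hp, ← hpos, ← hp] at hc
    exact h.commandsLeft_visit_lt hc (h.visit_see hp hk hpos hT)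

/-- At most two visits suffice to complete some command. -/
lemma InPhase.exists_progress (hn : 2 ≤ n) (hr : 1 ≤ r)
    (h : InPhase n r k φ q T β pos bal s w) (hq : q < n + r - 1) :
    ∃ w' : List (Fin n × Fin r), w'.length ≤ 2 ∧
      commandsLeft (w'.foldl (oscillatingProtocol n r).visit s) < commandsLeft s := by
  obtain ⟨a, ha⟩ : ∃ a : Fin n, (a : ℕ) = k := ⟨⟨k, h.k_lt⟩, rfl⟩
  have x₀ : Fin r := ⟨0, hr⟩
  obtain ⟨hβa, hpos | ⟨rfl, rfl, hk, hpos⟩⟩ := h.active a ha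
  · by_cases hx : ∃ x, T x = 0
    · obtain ⟨x, hx⟩ := hx
      exact ⟨[(a, x)], by simp, h.progress_active hn hq ha (Or.inl ⟨hpos, hx⟩)⟩
    have hT (x : Fin r) : T x = 1 := (h.room_bit x).resolve_left fun e => hx ⟨x, e⟩
    -- All real rooms have advanced but flips remain, so by `InPhase.sum_remaining` some virtual
    -- room has not advanced.
    obtain ⟨p, hp, hβ⟩ : ∃ p : Fin n, (p : ℕ) ≠ k ∧ β p = 0 := by
      by_contra hcon
      push Not at hcon
      have h0 : ∑ j : Fin n, ((if (j : ℕ) = k then 0 else 1) - (β j + bal j)) = 0 := by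
        refine Finset.sum_eq_zero fun j _ => ?_
        have h1 := h.held_bit j
        have h2 := h.balance j
        have h3 := h.active j
        have h4 := hcon j
        split_ifs <;> omega
      have hs := h.sum_remaining
      rw [h0] at hs
      simp only [hT, sub_self, Finset.sum_const_zero] at hs
      omega
    rcases h.command_passive hn p hp with ⟨hc, hz⟩ | ⟨-, -, hβ'⟩ | ⟨hc, rfl, -, hk⟩
    · refine ⟨[(p, x₀)], by simp, h.commandsLeft_visit_lt hc
        (h.visit_exchange p x₀ hp (hT x₀) hβ hz (Or.inl ?_))⟩
      simpa [hβ] using hc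
    · omega
    · by_cases hz : bal p = 0
      · exact ⟨[(p, x₀)], by simp, h.commandsLeft_visit_lt hc
          (h.visit_exchange p x₀ hp (hT x₀) hβ hz (Or.inr ⟨hc, rfl⟩))⟩
      · have hb := h.balance p
        -- A downward swing completes no command, but it leaves a `0` that the active prisoner can
        -- flip.
        refine ⟨[(p, x₀), (a, x₀)], by simp, ?_⟩
        have h' := h.visit_oscillate_down hk hβ (by omega) (hT x₀) hc
        exact (h'.progress_active hn hq ha (Or.inl ⟨hpos, by simp⟩)).trans_le
          (commandsLeft_visit_le s _)
  · by_cases hx : ∃ x, T x = 1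
    · obtain ⟨x, hx⟩ := hx
      exact ⟨[(a, x)], by simp,
        h.progress_active hn hq ha (Or.inr ⟨rfl, rfl, hk, hpos, hx⟩)⟩
    have hT (x : Fin r) : T x = 0 := (h.room_bit x).resolve_right fun e => hx ⟨x, e⟩
    obtain ⟨p, hp⟩ : ∃ p : Fin n, (p : ℕ) + 1 = k := ⟨⟨k - 1, by omega⟩, by simp; omega⟩
    -- Had `p` finished oscillating, no balance would be negative; with `q = 0` and every room at
    -- `0`, the count would then force all `β j` to vanish.
    have hβ : β p = 0 := by
      by_contra hβ
      have hz (j : Fin n) : bal j = 0 := by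
        rcases h.balance j with hz | ⟨-, hj, -, hj'⟩
        · exact hz
        · obtain rfl : j = p := Fin.ext (by omega)
          exact absurd hj' hβ
      have hcount := h.count
      simp only [hT, hz, add_zero, Finset.sum_const_zero, zero_add, Nat.cast_zero] at hcount
      have hnn : ∀ j ∈ Finset.univ, 0 ≤ β j := fun j _ => by
        have := h.held_bit j
        omega
      exact hβ ((Finset.sum_eq_zero_iff_of_nonneg hnn).1 hcount.symm p (Finset.mem_univ p))
    have hc : (program n r p)[pos p]? = some (.oscillate (color 1) (color 0)) := by
      have h1 := h.earlier p (by omega)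
      have h2 : pos p = activeStart p + 3 * (n + r - 1) := by omega
      rw [h2]
      exact program_oscillate hn (by have := h.k_lt; omega)
    -- The upward swing creates the `1` for which the active prisoner is waiting.
    refine ⟨[(p, x₀), (a, x₀)], by simp, ?_⟩
    have h' := h.visit_oscillate_up hp hβ (hT x₀) hc
    exact (h'.progress_active hn hq ha (Or.inr ⟨rfl, rfl, hk, hpos, by simp⟩)).trans_le
      (commandsLeft_visit_le s _)

lemma run_append {n r : ℕ} {C : Type} (P : Protocol n C) (c₀ : Fin r → C)
    (w w' : List (Fin n × Fin r)) : P.run c₀ (w ++ w') = w'.foldl P.visit (P.run c₀ w) := by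
  simp [Protocol.run]

/-- Induction on the number of uncompleted commands, at a cost of two visits each. With none left
the game must be finished, since otherwise the number could be lowered further. -/
lemma exists_declaresAfter (hn : 2 ≤ n) (hr : 1 ≤ r) (m : ℕ) (w : List (Fin n × Fin r))
    (hm : commandsLeft ((oscillatingProtocol n r).run (fun _ => 0) w) ≤ m) :
    ∃ w' : List (Fin n × Fin r), w'.length ≤ 2 * m ∧
      (oscillatingProtocol n r).DeclaresAfter (fun _ => 0) (w ++ w') := by
  induction m generalizing w with
  | zero =>
    rcases valid_run hn hr w with h | ⟨k, φ, q, T, β, pos, bal, hq, h⟩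
    · exact ⟨[], by simp, (List.append_nil w).symm ▸ h.2⟩
    · obtain ⟨w₁, -, h₁⟩ := h.exists_progress hn hr hq
      omega
  | succ m ih =>
    rcases valid_run hn hr w with h | ⟨k, φ, q, T, β, pos, bal, hq, h⟩
    · exact ⟨[], by simp, (List.append_nil w).symm ▸ h.2⟩
    · obtain ⟨w₁, hl₁, h₁⟩ := h.exists_progress hn hr hq
      rw [← run_append] at h₁
      obtain ⟨w₂, hl₂, h₂⟩ := ih (w ++ w₁) (by omega)
      refine ⟨w₁ ++ w₂, ?_, by rwa [← List.append_assoc]⟩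
      rw [List.length_append]
      omega

theorem mainTheorem6 (n r : ℕ) (hn : 2 ≤ n) (hr : 1 ≤ r) :
    (oscillatingProtocol n r).WinsWithProbabilityOne (fun _ : Fin r => (0 : Fin 3)) := by
  refine ⟨fun w hw => ?_, 2 * commandsLeft ((oscillatingProtocol n r).initial fun _ => 0),
    fun w => exists_declaresAfter hn hr _ w (commandsLeft_run_le w _)⟩
  rcases valid_run hn hr w with h | ⟨k, φ, q, T, β, pos, bal, hq, h⟩
  · exact h.1
  · obtain ⟨p, hp⟩ := hw
    exact absurd hp (h.not_declares hn hq p)
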